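/- Let $H$ and $A$ be (possibly unbounded) self-adjoint operators on a complex Hilbert space $\mathscr H$, let $s\ge 0$, let $\mathcal I\subset\mathbb R$ be a compact interval, and write $\langle A\rangle=(1+A^2)^{1/2}$. We say that the limiting absorption principle (LAP) for $H$ with respect to $(\mathcal I,s,A)$ holds if $$\sup_{\operatorname{Re} z\in\mathcal I,\ \operatorname{Im} z\neq 0}\bigl\|\langle A\rangle^{-s}(H-z)^{-1}\langle A\rangle^{-s}\bigr\|<\infty .$$ A special sequence for $H$ associated to $(\mathcal I,s,A)$ is a sequence $(f_n,z_n)_n$ in $\mathcal D(H)\times\mathbb C$ such that, for some $\lambda\in\mathcal I$ and some $\eta\ge 0$: $\operatorname{Re} z_n\in\mathcal I$ for all $n$ and $\operatorname{Re} z_n\to\lambda$; $\operatorname{Im} z_n\neq 0$ for all $n$ and $\operatorname{Im} z_n\to 0$; $\|\langle A\rangle^{-s}f_n\|\to\eta$; $(H-z_n)f_n\in\mathcal D(\langle A\rangle^{s})$ for all $n$; and $\|\langle A\rangle^{s}(H-z_n)f_n\|\to 0$. The number $\eta$ is called the mass of the special sequence. Then the LAP for $H$ with respect to $(\mathcal I,s,A)$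 is false if and only if there exists a special sequence for $H$ associated to $(\mathcal I,s,A)$ with positive mass. -/

import Mathlib

open Filter Topology

namespace Mourre

variable {E : Type*} [NormedAddCommGroup E] [InnerProductSpace ℂ E]

/-- `R` is the resolvent `(T - z)⁻¹` of the unbounded operator `T` at `z`: the bounded, everywhere
defined operator `R` is inverse to the bijection `T - z : D(T) → E`. -/
def IsResolventAt (T : E →ₗ.[ℂ] E) (z : ℂ) (R : E →L[ℂ] E) : Prop :=
  ∀ x y : E, R y = x ↔ ∃ hx : x ∈ T.domain, T ⟨x, hx⟩ - z • x = y

open Classical in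
/-- The resolvent `(T - z)⁻¹`, as a bounded operator (the value is `0` if `z` lies in the spectrum
of `T`; this does not occur for self-adjoint `T` and non-real `z`, see `isResolventAt_res`). -/
noncomputable def res (T : E →ₗ.[ℂ] E) (z : ℂ) : E →L[ℂ] E :=
  if h : ∃ R : E →L[ℂ] E, IsResolventAt T z R then h.choose else 0

/-- `(1 + A²)⁻¹ = (A - i)⁻¹ (A + i)⁻¹`; see `invOneAddSq_apply_eq_iff`. -/
noncomputable def invOneAddSq (A : E →ₗ.[ℂ] E) : E →L[ℂ] E :=
  res A Complex.I * res A (-Complex.I)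

section

variable [CompleteSpace E]

/-- `⟨A⟩^{-s}` with `⟨A⟩ = (1 + A²)^{1/2}`: the power `s / 2` of the nonnegative bounded operator
`(1 + A²)⁻¹`, in the continuous functional calculus. -/
noncomputable def japNeg (A : E →ₗ.[ℂ] E) (s : ℝ) : E →L[ℂ] E :=
  invOneAddSq A ^ (s / 2)

/-- `⟨A⟩^{s}`, the (in general unbounded) inverse of `⟨A⟩^{-s}`; its domain is the range
of `⟨A⟩^{-s}`. -/
noncomputable def japPow (A : E →ₗ.[ℂ] E) (s : ℝ) : E →ₗ.[ℂ] E :=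
  LinearPMap.inverse ((japNeg A s : E →ₗ[ℂ] E).toPMap ⊤)

/-- The limiting absorption principle for `H` with respect to the triplet `(I, s, A)`:
`sup_{Re z ∈ I, Im z ≠ 0} ‖⟨A⟩^{-s} (H - z)⁻¹ ⟨A⟩^{-s}‖ < ∞`. -/
def LAP (H : E →ₗ.[ℂ] E) (I : Set ℝ) (s : ℝ) (A : E →ₗ.[ℂ] E) : Prop :=
  BddAbove {r : ℝ | ∃ z : ℂ, z.re ∈ I ∧ z.im ≠ 0 ∧ r = ‖japNeg A s * res H z * japNeg A s‖}

/-- `(f n, z n)` is a special sequence for `H` associated to `(I, s, A)`, with mass `η`. -/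
structure IsSpecialSequence (H : E →ₗ.[ℂ] E) (I : Set ℝ) (s : ℝ) (A : E →ₗ.[ℂ] E)
    (f : ℕ → H.domain) (z : ℕ → ℂ) (η : ℝ) : Prop where
  mass_nonneg : 0 ≤ η
  re_mem : ∀ n, (z n).re ∈ I
  re_tendsto : ∃ l ∈ I, Tendsto (fun n => (z n).re) atTop (𝓝 l)
  im_ne_zero : ∀ n, (z n).im ≠ 0
  im_tendsto : Tendsto (fun n => (z n).im) atTop (𝓝 0)
  mass_tendsto : Tendsto (fun n => ‖japNeg A s (f n : E)‖) atTop (𝓝 η)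
  mem_domain : ∀ n, H (f n) - z n • (f n : E) ∈ (japPow A s).domain
  tendsto_zero :
    Tendsto (fun n => ‖japPow A s ⟨H (f n) - z n • (f n : E), mem_domain n⟩‖) atTop (𝓝 0)

/-! The objects above are the intended ones for self-adjoint operators. -/

theorem inner_symm {T : E →ₗ.[ℂ] E} (hT : IsSelfAdjoint T) (x y : T.domain) :
    inner ℂ (T x) (y : E) = inner ℂ (x : E) (T y) := by
  have h := LinearPMap.adjoint_isFormalAdjoint hT.dense_domain
  have h' : LinearPMap.adjoint T = T := hT
  rw [h'] at h
  exact h x y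

theorem le_norm_sub {T : E →ₗ.[ℂ] E} (hT : IsSelfAdjoint T) (z : ℂ) (x : T.domain) :
    |z.im| * ‖(x : E)‖ ≤ ‖T x - z • (x : E)‖ := by
  have hreal : (inner ℂ (x : E) (T x)).im = 0 := by
    have h1 := inner_symm hT x x
    have h2 := inner_conj_symm (𝕜 := ℂ) (x : E) (T x)
    rw [h1] at h2
    exact Complex.conj_eq_iff_im.mp h2
  have him : (inner ℂ (x : E) (T x - z • (x : E))).im = -(z.im * ‖(x : E)‖ ^ 2) := by
    rw [inner_sub_right, inner_smul_right, inner_self_eq_norm_sq_to_K, Complex.sub_im, hreal]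
    have : ((RCLike.ofReal ‖(x : E)‖ : ℂ)) ^ 2 = ((‖(x : E)‖ ^ 2 : ℝ) : ℂ) := by
      push_cast; rfl
    rw [this, Complex.im_mul_ofReal]
    ring
  have hle : |z.im| * ‖(x : E)‖ ^ 2 ≤ ‖(x : E)‖ * ‖T x - z • (x : E)‖ := by
    have h1 := Complex.abs_im_le_norm (inner ℂ (x : E) (T x - z • (x : E)))
    rw [him, abs_neg, abs_mul, abs_of_nonneg (sq_nonneg ‖(x : E)‖)] at h1
    exact h1.trans (norm_inner_le_norm _ _)
  rcases (norm_nonneg (x : E)).eq_or_lt with h0 | h0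
  · rw [← h0, mul_zero]; exact norm_nonneg _
  · refine le_of_mul_le_mul_left ?_ h0
    calc _ = |z.im| * ‖(x : E)‖ ^ 2 := by ring
      _ ≤ _ := hle

theorem surj_sub {T : E →ₗ.[ℂ] E} (hT : IsSelfAdjoint T) {z : ℂ} (hz : z.im ≠ 0) (y : E) :
    ∃ x : T.domain, T x - z • (x : E) = y := by
  let L : T.domain →ₗ[ℂ] E := T.toFun - z • T.domain.subtype
  have hL : ∀ x, L x = T x - z • (x : E) := fun x => rfl
  have hclosed : IsClosed (LinearMap.range L : Set E) := by
    refine isClosed_of_closure_subset fun w hw => ?_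
    obtain ⟨u, hu, hlim⟩ := mem_closure_iff_seq_limit.mp hw
    choose v hv using hu
    have hc : CauchySeq (fun n => (v n : E)) := by
      rw [Metric.cauchySeq_iff]
      intro ε hε
      have hpos : 0 < |z.im| := abs_pos.mpr hz
      obtain ⟨N, hN⟩ := Metric.cauchySeq_iff.mp hlim.cauchySeq (|z.im| * ε) (by positivity)
      refine ⟨N, fun m hm n hn => ?_⟩
      have h1 := hN m hm n hn
      rw [← hv, ← hv, dist_eq_norm, ← map_sub] at h1
      have h2 := le_norm_sub hT z (v m - v n)
      rw [← hL] at h2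
      have h3 := lt_of_mul_lt_mul_left (h2.trans_lt h1) hpos.le
      rw [dist_eq_norm]
      exact_mod_cast h3
    obtain ⟨x, hx⟩ := cauchySeq_tendsto_of_complete hc
    have hTv : Tendsto (fun n => T (v n)) atTop (𝓝 (w + z • x)) := by
      have h1 := hlim.add (hx.const_smul z)
      refine h1.congr fun n => ?_
      rw [← hv, hL, sub_add_cancel]
    have hg : (x, w + z • x) ∈ T.graph := by
      have hcl : IsClosed (T.graph : Set (E × E)) := hT.isClosed
      exact hcl.mem_of_tendsto (hx.prodMk_nhds hTv) (Eventually.of_forall fun n => T.mem_graph _)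
    obtain ⟨x', hx1, hx2⟩ := (LinearPMap.mem_graph_iff T).mp hg
    refine ⟨x', ?_⟩
    rw [hL]
    simp only at hx1 hx2
    rw [hx2, hx1, add_sub_cancel_right]
  have hbot : (LinearMap.range L)ᗮ = ⊥ := by
    rw [Submodule.eq_bot_iff]
    intro w hw
    have h0 : ∀ x : T.domain, inner ℂ (L x) w = 0 := fun x => hw _ ⟨x, rfl⟩
    have h1 : ∀ x : T.domain, inner ℂ ((starRingEnd ℂ z) • w) (x : E) = inner ℂ w (T x) := by
      intro x
      have h2 : inner ℂ w (L x) = 0 := by rw [← inner_conj_symm, h0, map_zero]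
      rw [hL, inner_sub_right, inner_smul_right, sub_eq_zero] at h2
      rw [h2, inner_smul_left, Complex.conj_conj]
    have h' : LinearPMap.adjoint T = T := hT
    have hmem : w ∈ (LinearPMap.adjoint T).domain :=
      LinearPMap.mem_adjoint_domain_of_exists w ⟨_, h1⟩
    have happ := LinearPMap.adjoint_apply_eq hT.dense_domain ⟨w, hmem⟩ h1
    have hg : (w, (starRingEnd ℂ z) • w) ∈ T.graph := by
      rw [← h', LinearPMap.mem_graph_iff]
      exact ⟨⟨w, hmem⟩, rfl, happ⟩
    obtain ⟨w', hw1, hw2⟩ := (LinearPMap.mem_graph_iff T).mp hg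
    simp only at hw1 hw2
    have h3 := le_norm_sub hT (starRingEnd ℂ z) w'
    rw [hw2, hw1, sub_self, norm_zero, Complex.conj_im, abs_neg] at h3
    have hpos : 0 < |z.im| := abs_pos.mpr hz
    exact norm_eq_zero.mp (le_antisymm (by nlinarith [norm_nonneg w]) (norm_nonneg w))
  have htop : LinearMap.range L = ⊤ := by
    have : CompleteSpace (LinearMap.range L) := hclosed.completeSpace_coe
    exact Submodule.orthogonal_eq_bot_iff.mp hbot
  obtain ⟨x, hx⟩ := LinearMap.range_eq_top.mp htop y
  exact ⟨x, hx⟩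

theorem exists_isResolventAt {T : E →ₗ.[ℂ] E} (hT : IsSelfAdjoint T) {z : ℂ} (hz : z.im ≠ 0) :
    ∃ R : E →L[ℂ] E, IsResolventAt T z R := by
  let L : T.domain →ₗ[ℂ] E := T.toFun - z • T.domain.subtype
  have hL : ∀ x, L x = T x - z • (x : E) := fun x => rfl
  have hpos : 0 < |z.im| := abs_pos.mpr hz
  have hinj : Function.Injective L := by
    rw [← LinearMap.ker_eq_bot, LinearMap.ker_eq_bot']
    intro x hx
    have h := le_norm_sub hT z x
    rw [← hL, hx, norm_zero] at h
    exact Subtype.ext (norm_eq_zero.mp (le_antisymm (by nlinarith [norm_nonneg (x : E)])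
      (norm_nonneg _)))
  let e : T.domain ≃ₗ[ℂ] E := LinearEquiv.ofBijective L ⟨hinj, fun y => surj_sub hT hz y⟩
  have he : ∀ x, e x = L x := fun x => rfl
  refine ⟨LinearMap.mkContinuous (T.domain.subtype ∘ₗ (e.symm : E →ₗ[ℂ] T.domain)) |z.im|⁻¹ ?_, ?_⟩
  · intro y
    have h := le_norm_sub hT z (e.symm y)
    rw [← hL, ← he, e.apply_symm_apply] at h
    rw [inv_mul_eq_div, le_div_iff₀ hpos, mul_comm]
    exact h
  · intro x y
    constructor
    · intro h
      have hx : ((e.symm y : T.domain) : E) = x := h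
      subst hx
      exact ⟨(e.symm y).2, (e.apply_symm_apply y : e (e.symm y) = y)⟩
    · rintro ⟨hx, h⟩
      have h1 : e ⟨x, hx⟩ = y := h
      change ((e.symm y : T.domain) : E) = x
      rw [← h1, e.symm_apply_apply]

/-- For self-adjoint `T` and non-real `z`, `res T z` is the resolvent. -/
theorem isResolventAt_res {T : E →ₗ.[ℂ] E} (hT : IsSelfAdjoint T) {z : ℂ} (hz : z.im ≠ 0) :
    IsResolventAt T z (res T z) := by
  have h := exists_isResolventAt hT hz
  rw [res, dif_pos h]
  exact h.choose_spec

/-- `invOneAddSq A` is the inverse of `1 + A² : D(A²) → E`. -/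
theorem invOneAddSq_apply_eq_iff {A : E →ₗ.[ℂ] E} (hA : IsSelfAdjoint A) (x y : E) :
    invOneAddSq A y = x ↔
      ∃ (hx : x ∈ A.domain) (hx' : A ⟨x, hx⟩ ∈ A.domain), x + A ⟨A ⟨x, hx⟩, hx'⟩ = y := by
  have h1 := isResolventAt_res hA (z := Complex.I) (by simp)
  have h2 := isResolventAt_res hA (z := -Complex.I) (by simp)
  have key : ∀ (hx : x ∈ A.domain) (hx' : A ⟨x, hx⟩ ∈ A.domain)
      (hw : A ⟨x, hx⟩ - Complex.I • x ∈ A.domain),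
      A ⟨A ⟨x, hx⟩ - Complex.I • x, hw⟩ - (-Complex.I) • (A ⟨x, hx⟩ - Complex.I • x) =
        x + A ⟨A ⟨x, hx⟩, hx'⟩ := by
    intro hx hx' hw
    have h3 : (⟨A ⟨x, hx⟩ - Complex.I • x, hw⟩ : A.domain) =
        ⟨A ⟨x, hx⟩, hx'⟩ - Complex.I • ⟨x, hx⟩ := rfl
    rw [h3, LinearPMap.map_sub, LinearPMap.map_smul, smul_sub, smul_smul, neg_mul,
      Complex.I_mul_I, neg_neg, one_smul, neg_smul]
    abel
  change res A Complex.I (res A (-Complex.I) y) = x ↔ _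
  rw [h1]
  constructor
  · rintro ⟨hx, h⟩
    obtain ⟨hw, h'⟩ := (h2 _ _).mp h.symm
    have hx' : A ⟨x, hx⟩ ∈ A.domain := by
      have := A.domain.add_mem hw (A.domain.smul_mem Complex.I hx)
      rwa [sub_add_cancel] at this
    exact ⟨hx, hx', (key hx hx' hw).symm.trans h'⟩
  · rintro ⟨hx, hx', h⟩
    have hw : A ⟨x, hx⟩ - Complex.I • x ∈ A.domain :=
      A.domain.sub_mem hx' (A.domain.smul_mem _ hx)
    exact ⟨hx, ((h2 _ _).mpr ⟨hw, (key hx hx' hw).trans h⟩).symm⟩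

theorem invOneAddSq_nonneg {A : E →ₗ.[ℂ] E} (hA : IsSelfAdjoint A) : 0 ≤ invOneAddSq A := by
  have h1 := isResolventAt_res hA (z := Complex.I) (by simp)
  have h2 := isResolventAt_res hA (z := -Complex.I) (by simp)
  have hadj : res A Complex.I = ContinuousLinearMap.adjoint (res A (-Complex.I)) := by
    rw [ContinuousLinearMap.eq_adjoint_iff]
    intro y w
    obtain ⟨hx, hy⟩ := (h1 _ _).mp (rfl : res A Complex.I y = _)
    obtain ⟨hu, hw⟩ := (h2 _ _).mp (rfl : res A (-Complex.I) w = _)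
    have hs := inner_symm hA ⟨_, hx⟩ ⟨_, hu⟩
    generalize res A Complex.I y = x at *
    generalize res A (-Complex.I) w = u at *
    rw [← hy, ← hw, inner_sub_left, inner_sub_right, inner_smul_left, inner_smul_right]
    simp only at hs
    rw [hs, Complex.conj_I]
  rw [ContinuousLinearMap.nonneg_iff_isPositive, invOneAddSq, hadj]
  exact ContinuousLinearMap.isPositive_adjoint_comp_self _

theorem invOneAddSq_injective {A : E →ₗ.[ℂ] E} (hA : IsSelfAdjoint A) :
    Function.Injective (invOneAddSq A) := by
  intro y y' h
  obtain ⟨hx, hx', hy⟩ := (invOneAddSq_apply_eq_iff hA _ y).mp rfl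
  obtain ⟨hu, hu', hy'⟩ := (invOneAddSq_apply_eq_iff hA _ y').mp rfl
  rw [← hy, ← hy']
  simp only [h]

theorem japNeg_mul {A : E →ₗ.[ℂ] E} (hA : IsSelfAdjoint A) {s t : ℝ} (hs : 0 ≤ s) (ht : 0 ≤ t) :
    japNeg A s * japNeg A t = japNeg A (s + t) := by
  have := invOneAddSq_nonneg hA
  simp only [japNeg, CFC.rpow_def]
  rw [← cfc_mul _ _ (invOneAddSq A)
    (NNReal.continuous_rpow_const (by positivity)).continuousOn
    (NNReal.continuous_rpow_const (by positivity)).continuousOn]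
  congr 1
  ext x
  rw [add_div, NNReal.rpow_add_of_nonneg _ (by positivity) (by positivity)]

theorem japNeg_zero {A : E →ₗ.[ℂ] E} (hA : IsSelfAdjoint A) : japNeg A 0 = 1 := by
  rw [japNeg, zero_div, CFC.rpow_zero _ (invOneAddSq_nonneg hA)]

theorem japNeg_two {A : E →ₗ.[ℂ] E} (hA : IsSelfAdjoint A) : japNeg A 2 = invOneAddSq A := by
  rw [japNeg, div_self two_ne_zero, CFC.rpow_one _ (invOneAddSq_nonneg hA)]

theorem japNeg_injective {A : E →ₗ.[ℂ] E} (hA : IsSelfAdjoint A) {s : ℝ} (hs : 0 ≤ s) :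
    Function.Injective (japNeg A s) := by
  obtain ⟨n, hn⟩ := exists_nat_ge (s / 2)
  have h1 : japNeg A (2 * n - s) * japNeg A s = invOneAddSq A ^ n := by
    rw [japNeg_mul hA (by linarith) hs, sub_add_cancel, japNeg,
      mul_div_cancel_left₀ _ two_ne_zero, CFC.rpow_natCast _ _ (invOneAddSq_nonneg hA)]
  have h2 : Function.Injective ((invOneAddSq A ^ n : E →L[ℂ] E) : E → E) := by
    clear hn h1
    induction n with
    | zero => exact fun x y h => h
    | succ k ih =>
      rw [pow_succ]
      exact ih.comp (invOneAddSq_injective hA)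
  intro x y h
  refine h2 ?_
  rw [← h1]
  change japNeg A _ (japNeg A s x) = japNeg A _ (japNeg A s y)
  rw [h]

/-- `x ∈ D(⟨A⟩^s)` and `⟨A⟩^s x = y` if and only if `x = ⟨A⟩^{-s} y`. -/
theorem mem_graph_japPow_iff {A : E →ₗ.[ℂ] E} (hA : IsSelfAdjoint A) {s : ℝ} (hs : 0 ≤ s)
    (x y : E) : (x, y) ∈ (japPow A s).graph ↔ japNeg A s y = x := by
  have hker : LinearMap.ker ((japNeg A s : E →ₗ[ℂ] E).toPMap ⊤).toFun = ⊥ := by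
    rw [LinearMap.ker_eq_bot']
    intro w hw
    refine Subtype.ext (japNeg_injective hA hs ?_)
    rw [ZeroMemClass.coe_zero, map_zero]
    exact hw
  rw [japPow, LinearPMap.inverse_graph hker]
  simp only [Submodule.mem_map, Prod.exists, LinearEquiv.coe_coe, LinearEquiv.prodComm_apply,
    Prod.swap_prod_mk, Prod.mk.injEq, LinearPMap.mem_graph_iff]
  constructor
  · rintro ⟨a, b, ⟨w, rfl, hw⟩, rfl, rfl⟩
    exact hw
  · intro h
    exact ⟨y, x, ⟨⟨y, trivial⟩, rfl, h⟩, rfl, rfl⟩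

end

end Mourre

namespace Mourre

section

variable {E : Type*} [NormedAddCommGroup E] [InnerProductSpace ℂ E] [CompleteSpace E]

/-! Write `W = ⟨A⟩^{-s}` and `K(z) = W (H - z)⁻¹ W`. If `g = ⟨A⟩^s (H - z) f`, then `W f = K(z) g`.
A special sequence thus amounts to vectors `g_n → 0` with `‖K(z_n) g_n‖ → η`, and a uniform bound on
`K` forces `η = 0` (`IsSpecialSequence.mass_eq_zero`). Conversely, if `K` is unbounded, there are
`φ_n → 0` with `‖K(z_n) φ_n‖ = 1`, and `f_n = (H - z_n)⁻¹ W φ_n` has mass one. The bound `‖K(z)‖ ≤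
‖W‖² / |Im z|`, from `norm_res_le`, makes `Im z_n → 0` automatic, and compactness of the interval
makes `Re z_n` converge along a subsequence. -/

theorem norm_res_le {T : E →ₗ.[ℂ] E} (hT : IsSelfAdjoint T) {z : ℂ} (hz : z.im ≠ 0) :
    ‖res T z‖ ≤ |z.im|⁻¹ := by
  refine ContinuousLinearMap.opNorm_le_bound _ (by positivity) fun y => ?_
  obtain ⟨hx, hy⟩ := (isResolventAt_res hT hz _ _).mp (rfl : res T z y = _)
  have h := le_norm_sub hT z ⟨_, hx⟩
  rw [hy] at h
  rwa [inv_mul_eq_div, le_div_iff₀ (abs_pos.mpr hz), mul_comm]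

theorem mem_domain_japPow {A : E →ₗ.[ℂ] E} (hA : IsSelfAdjoint A) {s : ℝ} (hs : 0 ≤ s)
    {x y : E} (h : japNeg A s y = x) : x ∈ (japPow A s).domain :=
  LinearPMap.mem_domain_of_mem_graph ((mem_graph_japPow_iff hA hs x y).mpr h)

/-- Both sides have the same image under the injective `japNeg A s`. Keeping `hx` arbitrary lets the
result apply to whichever membership proof a special sequence carries. -/
theorem japPow_apply {A : E →ₗ.[ℂ] E} (hA : IsSelfAdjoint A) {s : ℝ} (hs : 0 ≤ s)
    {x y : E} (h : japNeg A s y = x) (hx : x ∈ (japPow A s).domain) :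
    japPow A s ⟨x, hx⟩ = y :=
  japNeg_injective hA hs
    (((mem_graph_japPow_iff hA hs _ _).mp ((japPow A s).mem_graph ⟨x, hx⟩)).trans h.symm)

theorem japNeg_japPow {A : E →ₗ.[ℂ] E} (hA : IsSelfAdjoint A) {s : ℝ} (hs : 0 ≤ s)
    (x : (japPow A s).domain) : japNeg A s (japPow A s x) = x :=
  (mem_graph_japPow_iff hA hs _ _).mp ((japPow A s).mem_graph x)

/-- Under the limiting absorption principle every special sequence has mass zero. -/
theorem IsSpecialSequence.mass_eq_zero {H A : E →ₗ.[ℂ] E} (hH : IsSelfAdjoint H)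
    (hA : IsSelfAdjoint A) {s : ℝ} (hs : 0 ≤ s) {I : Set ℝ} {f : ℕ → H.domain} {z : ℕ → ℂ} {η : ℝ}
    (h : IsSpecialSequence H I s A f z η) (hLAP : LAP H I s A) : η = 0 := by
  obtain ⟨C, hC⟩ := hLAP
  refine tendsto_nhds_unique h.mass_tendsto
    (squeeze_zero (fun n => norm_nonneg _) (fun n => ?_)
      (by simpa using h.tendsto_zero.const_mul C))
  have hres : res H (z n) (H (f n) - z n • (f n : E)) = f n :=
    (isResolventAt_res hH (h.im_ne_zero n) _ _).mpr ⟨(f n).2, rfl⟩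
  have hg := japNeg_japPow hA hs ⟨_, h.mem_domain n⟩
  -- The identity `W f = K(z) g`, with `hg` and `hres` undoing `⟨A⟩^s` and `H - z` in turn.
  calc ‖japNeg A s (f n : E)‖
      = ‖(japNeg A s * res H (z n) * japNeg A s) (japPow A s ⟨_, h.mem_domain n⟩)‖ := by
        simp only [mul_apply_eq_comp, hg, hres]
    _ ≤ ‖japNeg A s * res H (z n) * japNeg A s‖ * _ := ContinuousLinearMap.le_opNorm _ _
    _ ≤ C * _ := by
        gcongr
        exact hC ⟨z n, h.re_mem n, h.im_ne_zero n, rfl⟩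

/-- Where the limiting absorption principle fails, the weighted resolvent maps vectors tending
to zero onto unit vectors, along spectral parameters tending to the real axis. -/
theorem exists_seq_of_not_LAP {H A : E →ₗ.[ℂ] E} (hH : IsSelfAdjoint H) {s : ℝ} {I : Set ℝ}
    (hLAP : ¬ LAP H I s A) :
    ∃ (z : ℕ → ℂ) (φ : ℕ → E), (∀ n, (z n).re ∈ I) ∧ (∀ n, (z n).im ≠ 0) ∧
      Tendsto (fun n => (z n).im) atTop (𝓝 0) ∧ Tendsto (fun n => ‖φ n‖) atTop (𝓝 0) ∧
      ∀ n, ‖(japNeg A s * res H (z n) * japNeg A s) (φ n)‖ = 1 := by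
  have hex : ∀ n : ℕ, ∃ (z : ℂ) (φ : E), z.re ∈ I ∧ z.im ≠ 0 ∧
      |z.im| ≤ ‖japNeg A s‖ * ‖japNeg A s‖ * (1 / ((n : ℝ) + 1)) ∧ ‖φ‖ ≤ 1 / ((n : ℝ) + 1) ∧
      ‖(japNeg A s * res H z * japNeg A s) φ‖ = 1 := by
    intro n
    have hn : (0 : ℝ) < (n : ℝ) + 1 := by positivity
    obtain ⟨_, ⟨z, hre, him, rfl⟩, hlt⟩ := not_bddAbove_iff.mp hLAP ((n : ℝ) + 1)
    obtain ⟨ψ, hψ⟩ : ∃ ψ, ((n : ℝ) + 1) * ‖ψ‖ < ‖(japNeg A s * res H z * japNeg A s) ψ‖ := by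
      by_contra! hle
      exact hlt.not_ge (ContinuousLinearMap.opNorm_le_bound _ hn.le hle)
    have hpos : 0 < ‖(japNeg A s * res H z * japNeg A s) ψ‖ :=
      (mul_nonneg hn.le (norm_nonneg _)).trans_lt hψ
    -- Scaling `ψ` so that its image is a unit vector turns `hψ` into the bound `1 / (n + 1)` on its
    -- norm.
    refine ⟨z, ((‖(japNeg A s * res H z * japNeg A s) ψ‖⁻¹ : ℝ) : ℂ) • ψ, hre, him, ?_, ?_, ?_⟩
    -- A weighted resolvent of norm above `n + 1` can only occur close to the real axis.
    · have hle : (n : ℝ) + 1 ≤ ‖japNeg A s‖ * |z.im|⁻¹ * ‖japNeg A s‖ :=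
        hlt.le.trans <| (norm_mul_le _ _).trans <| by
          gcongr
          exact (norm_mul_le _ _).trans (by gcongr; exact norm_res_le hH him)
      have hz := abs_pos.mpr him
      rw [mul_one_div, le_div_iff₀ hn]
      calc |z.im| * ((n : ℝ) + 1)
          ≤ |z.im| * (‖japNeg A s‖ * |z.im|⁻¹ * ‖japNeg A s‖) := by gcongr
        _ = ‖japNeg A s‖ * ‖japNeg A s‖ := by field_simp
    · rw [norm_smul, Complex.norm_real, Real.norm_of_nonneg (by positivity), inv_mul_eq_div,
        div_le_div_iff₀ hpos hn, one_mul, mul_comm]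
      exact hψ.le
    · rw [map_smul, norm_smul, Complex.norm_real, Real.norm_of_nonneg (by positivity),
        inv_mul_cancel₀ hpos.ne']
  choose z φ hre him hz hφ hone using hex
  have hlim := tendsto_one_div_add_atTop_nhds_zero_nat (𝕜 := ℝ)
  refine ⟨z, φ, hre, him, ?_, squeeze_zero (fun n => norm_nonneg _) hφ hlim, hone⟩
  exact squeeze_zero_norm hz (by simpa using hlim.const_mul (‖japNeg A s‖ * ‖japNeg A s‖))

/-- If the limiting absorption principle fails over a compact set of energies, then there is a
special sequence of mass one. -/
theorem exists_isSpecialSequence_of_not_LAP {H A : E →ₗ.[ℂ] E} (hH : IsSelfAdjoint H)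
    (hA : IsSelfAdjoint A) {s : ℝ} (hs : 0 ≤ s) {I : Set ℝ} (hI : IsCompact I)
    (hLAP : ¬ LAP H I s A) :
    ∃ (f : ℕ → H.domain) (z : ℕ → ℂ), IsSpecialSequence H I s A f z 1 := by
  obtain ⟨z, φ, hre, him, hz, hφ, hone⟩ := exists_seq_of_not_LAP hH hLAP
  -- The only use of compactness: the real parts have a limit point inside `I`.
  obtain ⟨l, hl, k, hk, hlim⟩ := hI.tendsto_subseq hre
  have hres : ∀ n, ∃ hx : res H (z n) (japNeg A s (φ n)) ∈ H.domain,
      H ⟨_, hx⟩ - z n • res H (z n) (japNeg A s (φ n)) = japNeg A s (φ n) := fun n =>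
    (isResolventAt_res hH (him n) _ _).mp rfl
  choose hdom heq using hres
  -- With `f_n = (H - z_n)⁻¹ W φ_n` along the subsequence, `⟨A⟩^s (H - z_n) f_n` is `φ_n` itself,
  -- and `‖W f_n‖` is constantly one.
  refine ⟨fun n => ⟨_, hdom (k n)⟩, z ∘ k,
    { mass_nonneg := zero_le_one
      re_mem := fun n => hre (k n)
      re_tendsto := ⟨l, hl, hlim⟩
      im_ne_zero := fun n => him (k n)
      im_tendsto := hz.comp hk.tendsto_atTop
      mass_tendsto := tendsto_const_nhds.congr fun n => (hone (k n)).symm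
      mem_domain := fun n => mem_domain_japPow hA hs (heq (k n)).symm
      tendsto_zero := (hφ.comp hk.tendsto_atTop).congr fun n => ?_ }⟩
  exact congrArg norm (japPow_apply hA hs (heq (k n)).symm _).symm

end

end Mourre

theorem proposition2 {E : Type*} [NormedAddCommGroup E] [InnerProductSpace ℂ E] [CompleteSpace E]
    (H A : E →ₗ.[ℂ] E) (hH : IsSelfAdjoint H) (hA : IsSelfAdjoint A)
    (s : ℝ) (hs : 0 ≤ s) (I : Set ℝ) (hI : I.OrdConnected) (hIc : IsCompact I) :
    ¬ Mourre.LAP H I s A ↔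
      ∃ (f : ℕ → H.domain) (z : ℕ → ℂ) (η : ℝ),
        Mourre.IsSpecialSequence H I s A f z η ∧ 0 < η := by
  constructor
  · intro hLAP
    obtain ⟨f, z, h⟩ := Mourre.exists_isSpecialSequence_of_not_LAP hH hA hs hIc hLAP
    exact ⟨f, z, 1, h, zero_lt_one⟩
  · rintro ⟨f, z, η, h, hη⟩ hLAP
    exact hη.ne' (h.mass_eq_zero hH hA hs hLAP)
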